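/- An $n$-tree is a rooted tree of height $n$ in which every vertex at distance less than $n$ from the root has exactly $n$ children. For every $n\in\mathbb N$ there exists an $N\in\mathbb N$ such that every finite simple graph containing an $N$-tree as a (not necessarily induced) subgraph contains the complete graph $K_n$, the complete bipartite graph $K_{n,n}$, or an $n$-tree as an induced subgraph. -/

import Mathlib

/-- The vertices of the complete `k`-ary tree of height `h`: words of length at most `h` over an
alphabet of `k` letters. The root is the empty word, and generation `i` consists of the words
of length `i`. -/
abbrev KaryWord (k h : ℕ) : Type := {w : List (Fin k) // w.length ≤ h}

/-- The complete `k`-ary tree of height `h`, as a simple graph: the children of a word `u` of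
length less than `h` are the `k` words `a :: u`, and every edge joins a word with one of
its children. -/
def karyTree (k h : ℕ) : SimpleGraph (KaryWord k h) where
  Adj u v := (∃ a, v.1 = a :: u.1) ∨ (∃ a, u.1 = a :: v.1)
  symm := ⟨fun _ _ huv => huv.symm⟩
  loopless := ⟨fun _ huv => by
    rcases huv with ⟨a, ha⟩ | ⟨a, ha⟩ <;> simp at ha⟩

/-- The `n`-tree: the rooted tree of height `n` in which every vertex of generation `i < n` has
exactly `n` children. -/
abbrev nTree (n : ℕ) : SimpleGraph (KaryWord n n) := karyTree n n

/-! ### Ramsey's theorem for pairs -/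

/-! By Ramsey, a large `K_{m,m}` subgraph yields a clique or an induced `K_{n,n}`, so `K_{m,m}` may
be excluded. The tree is then thinned until only parent-child edges remain.

Comparable vertices (`exists_subtree_without_back_edges`): colouring each leaf by the adjacencies
along its root path and passing to a monochromatic subtree makes adjacency of comparable vertices
depend on their levels only. This gives a graph on the levels. If a level `j` had `m` smaller
neighbours, `m` ancestors and `m` siblings at level `j` would form a `K_{m,m}`. With backward
degrees bounded, a shortest increasing path is long and induced; its levels are kept and the others
contracted.

Incomparable vertices (`exists_subtree_without_cross_edges`): by induction on the height, Ramsey is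
applied to the children of the root, a pair being coloured by the positions of an edge between their
subtrees. A colour other than "no edge" would again give a `K_{m,m}`. This thinning preserves levels
and ancestry, so it does not spoil the previous one. -/

theorem Finset.exists_strictMono_enumeration (S : Finset ℕ) (s : ℕ) (hs : s ≤ S.card) :
    ∃ g : ℕ → ℕ, (∀ i < s, g i ∈ S) ∧ ∀ i j, i < j → j < s → g i < g j := by
  refine ⟨fun i => if h : i < S.card then S.orderEmbOfFin rfl ⟨i, h⟩ else 0, ?_, ?_⟩
  · intro i hi
    simp [show i < S.card by omega]
  · intro i j hij hj
    simp [show i < S.card by omega, show j < S.card by omega, hij]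

/-- In a large set of natural numbers there is a sequence of prescribed length along which the
colour of a pair depends only on its smaller element. -/
theorem exists_endHomogeneous (C : Type) [Finite C] (L : ℕ) :
    ∃ R : ℕ, ∀ (c : ℕ → ℕ → C) (A : Finset ℕ), R ≤ A.card →
      ∃ (g : ℕ → ℕ) (d : ℕ → C), (∀ i < L, g i ∈ A) ∧
        ∀ i j, i < j → j < L → g i < g j ∧ c (g i) (g j) = d i := by
  classical
  have := Fintype.ofFinite C
  induction L with
  | zero => exact ⟨0, fun c A _ => ⟨id, fun _ => c 0 0, by simp, by simp⟩⟩
  | succ L ih =>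
    obtain ⟨R, hR⟩ := ih
    -- The minimum of `A` comes first; of the other elements, at least `R` receive the same colour
    -- with it.
    refine ⟨Fintype.card C * R + 1, fun c A hA => ?_⟩
    have hne : A.Nonempty := Finset.card_pos.1 (by omega)
    set a := A.min' hne
    have hmem : a ∈ A := A.min'_mem hne
    have : Nonempty C := ⟨c 0 0⟩
    obtain ⟨κ, -, hκ⟩ := Finset.exists_le_card_fiber_of_mul_le_card_of_maps_to
      (s := A.erase a) (t := Finset.univ) (f := c a) (n := R) (by simp) Finset.univ_nonempty
      (by rw [Finset.card_erase_of_mem hmem, Finset.card_univ]; omega)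
    obtain ⟨g, d, hg, hgd⟩ := hR c _ hκ
    simp only [Finset.mem_filter, Finset.mem_erase] at hg
    refine ⟨fun i => Nat.casesOn i a g, fun i => Nat.casesOn i κ d, ?_, ?_⟩
    · rintro (_ | i) hi
      · exact hmem
      · exact (hg i (by omega)).1.2
    · rintro (_ | i) (_ | j) hij hj
      · omega
      · obtain ⟨⟨h1, h2⟩, h3⟩ := hg j (by omega)
        exact ⟨lt_of_le_of_ne (A.min'_le _ h2) (Ne.symm h1), h3⟩
      · omega
      · exact hgd i j (by omega) (by omega)

/-- Pigeonhole on the colours `d i` of an end-homogeneous sequence of length `card C * s`. -/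
theorem exists_ramsey (C : Type) [Finite C] (s : ℕ) :
    ∃ R : ℕ, ∀ c : ℕ → ℕ → C, ∃ (g : ℕ → ℕ) (κ : C), (∀ i < s, g i < R) ∧
      ∀ i j, i < j → j < s → g i < g j ∧ c (g i) (g j) = κ := by
  classical
  have := Fintype.ofFinite C
  obtain ⟨R, hR⟩ := exists_endHomogeneous C (Fintype.card C * s)
  refine ⟨R, fun c => ?_⟩
  obtain ⟨g, d, hg, hgd⟩ := hR c (Finset.range R) (by simp)
  have : Nonempty C := ⟨c 0 0⟩
  obtain ⟨κ, -, hκ⟩ := Finset.exists_le_card_fiber_of_mul_le_card_of_maps_to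
    (s := Finset.range (Fintype.card C * s)) (t := Finset.univ) (f := d) (n := s) (by simp)
    Finset.univ_nonempty (by simp)
  obtain ⟨e, he, hmono⟩ := Finset.exists_strictMono_enumeration _ s hκ
  simp only [Finset.mem_filter, Finset.mem_range] at he
  refine ⟨g ∘ e, κ, fun i hi => by simpa using hg _ (he i hi).1, fun i j hij hj => ?_⟩
  obtain ⟨h1, h2⟩ := hgd _ _ (hmono i j hij hj) (he j hj).1
  exact ⟨h1, h2.trans (he i (by omega)).2⟩

/-! ### Bicliques -/

/-- `G` contains `K_{m,m}` as a subgraph. -/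
def HasBiclique {V : Type*} (G : SimpleGraph V) (m : ℕ) : Prop :=
  ∃ p q : Fin m → V, p.Injective ∧ q.Injective ∧ ∀ i j, G.Adj (p i) (q j)

theorem exists_clique_or_indep (n : ℕ) :
    ∃ m : ℕ, ∀ {V : Type*} (G : SimpleGraph V) (p : Fin m → V), p.Injective →
      ∃ g : Fin n → Fin m, g.Injective ∧
        ((∀ i j, i ≠ j → G.Adj (p (g i)) (p (g j))) ∨
          ∀ i j, ¬ G.Adj (p (g i)) (p (g j))) := by
  classical
  obtain ⟨R, hR⟩ := exists_ramsey Bool n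
  refine ⟨R, fun {V} G p hp => ?_⟩
  obtain ⟨g, κ, hgR, hg⟩ := hR fun i j =>
    if h : i < R ∧ j < R then decide (G.Adj (p ⟨i, h.1⟩) (p ⟨j, h.2⟩)) else false
  have key : ∀ i j : Fin n, i < j →
      decide (G.Adj (p ⟨g i, hgR i i.2⟩) (p ⟨g j, hgR j j.2⟩)) = κ := by
    intro i j hij
    have := (hg i j hij j.2).2
    rwa [dif_pos ⟨hgR i i.2, hgR j j.2⟩] at this
  refine ⟨fun i => ⟨g i, hgR i i.2⟩, ?_, ?_⟩
  · intro i j hij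
    have hij : g i = g j := by simpa using hij
    rcases lt_trichotomy i j with h | h | h
    · have := (hg i j h j.2).1; omega
    · exact h
    · have := (hg j i h i.2).1; omega
  · cases κ
    · right
      intro i j
      rcases lt_trichotomy i j with h | h | h
      · simpa using key i j h
      · subst h; exact G.loopless.irrefl _
      · rw [G.adj_comm]; simpa using key j i h
    · left
      intro i j hij
      rcases lt_or_gt_of_ne hij with h | h
      · simpa using key i j h
      · rw [G.adj_comm]; simpa using key j i h

/-- A large biclique subgraph yields a clique or an induced biclique. -/
theorem exists_forall_hasBiclique_imp (n : ℕ) :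
    ∃ m : ℕ, ∀ {V : Type*} (G : SimpleGraph V), HasBiclique G m →
      (SimpleGraph.completeGraph (Fin n)).IsIndContained G ∨
        (completeBipartiteGraph (Fin n) (Fin n)).IsIndContained G := by
  obtain ⟨m, hm⟩ := exists_clique_or_indep n
  refine ⟨m, fun {V} G => ?_⟩
  rintro ⟨p, q, hp, hq, hpq⟩
  have clique : ∀ r : Fin n → V, r.Injective → (∀ i j, i ≠ j → G.Adj (r i) (r j)) →
      (SimpleGraph.completeGraph (Fin n)).IsIndContained G := fun r hr h =>
    ⟨⟨⟨r, hr⟩, fun {i j} => ⟨fun hij => fun e => hij.ne (congrArg r e), fun hij => h i j hij⟩⟩⟩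
  obtain ⟨g, hg, h1 | h1⟩ := hm G p hp
  · exact Or.inl (clique _ (hp.comp hg) h1)
  obtain ⟨k, hk, h2 | h2⟩ := hm G q hq
  · exact Or.inl (clique _ (hq.comp hk) h2)
  refine Or.inr ⟨⟨⟨Sum.elim (p ∘ g) (q ∘ k), ?_⟩, ?_⟩⟩
  · exact (hp.comp hg).sumElim (hq.comp hk) fun i j => (hpq _ _).ne
  · rintro (i | i) (j | j)
    · simpa using h1 i j
    · simpa using hpq _ _
    · simpa using (hpq _ _).symm
    · simpa using h2 i j

/-! ### Increasing induced paths -/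

/-- Numbers from which `h` can be reached by at most `t` increasing steps along `H`. -/
def stepsTo (H : ℕ → ℕ → Prop) (h : ℕ) : ℕ → Set ℕ
  | 0 => {h}
  | t + 1 => stepsTo H h t ∪ {a | ∃ c ∈ stepsTo H h t, a < c ∧ H a c}

theorem stepsTo_le {H : ℕ → ℕ → Prop} {h t a : ℕ} (ha : a ∈ stepsTo H h t) : a ≤ h := by
  induction t generalizing a with
  | zero => exact le_of_eq ha
  | succ t ih =>
    rcases ha with ha | ⟨c, hc, hac, -⟩
    · exact ih ha
    · exact hac.le.trans (ih hc)

theorem stepsTo_mono (H : ℕ → ℕ → Prop) (h : ℕ) : Monotone (stepsTo H h) :=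
  monotone_nat_of_le_succ fun _ => Set.subset_union_left

/-- Each element contributes itself and at most `m` backward neighbours to the next set. -/
theorem stepsTo_ncard_le {H : ℕ → ℕ → Prop} {h m : ℕ}
    (hH : ∀ j ≤ h, {i | i < j ∧ H i j}.encard ≤ m) (t : ℕ) :
    (stepsTo H h t).ncard ≤ (m + 1) ^ t := by
  have hfin : ∀ t, (stepsTo H h t).Finite := fun t =>
    (Set.finite_Iic h).subset fun _ => stepsTo_le
  induction t with
  | zero => simp [stepsTo]
  | succ t ih =>
    have hsub : stepsTo H h (t + 1) ⊆
        stepsTo H h t ∪ ⋃ c ∈ (hfin t).toFinset, {a | a < c ∧ H a c} := by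
      rintro a (ha | ⟨c, hc, h1⟩)
      · exact Or.inl ha
      · exact Or.inr (Set.mem_biUnion ((hfin t).mem_toFinset.2 hc) h1)
    have hU : (⋃ c ∈ (hfin t).toFinset, {a | a < c ∧ H a c}).ncard
        ≤ (hfin t).toFinset.card * m := by
      refine (Finset.set_ncard_biUnion_le _ _).trans ?_
      refine (Finset.sum_le_card_nsmul _ _ m fun c hc => ?_).trans (by simp)
      have h1 := hH c (stepsTo_le ((hfin t).mem_toFinset.1 hc))
      rw [Set.ncard]
      exact ENat.toNat_le_of_le_natCast h1
    have hUfin : (⋃ c ∈ (hfin t).toFinset, {a | a < c ∧ H a c}).Finite :=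
      (hfin t).toFinset.finite_toSet.biUnion fun c _ =>
        (Set.finite_Iio c).subset fun a ha => ha.1
    calc _ ≤ _ := Set.ncard_le_ncard hsub ((hfin t).union hUfin)
      _ ≤ _ := Set.ncard_union_le _ _
      _ ≤ (stepsTo H h t).ncard + (hfin t).toFinset.card * m := by gcongr
      _ = (stepsTo H h t).ncard * (m + 1) := by
        rw [← Set.ncard_eq_toFinset_card _ (hfin t)]; ring
      _ ≤ _ := by rw [pow_succ]; gcongr

/-- Along a shortest path the distance to `h` drops by exactly one per step; recording the exact
distances is what later excludes chords. -/
theorem exists_geodesic {H : ℕ → ℕ → Prop} {h t a : ℕ} (ha : a ∈ stepsTo H h t)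
    (hmin : ∀ s < t, a ∉ stepsTo H h s) :
    ∃ e : ℕ → ℕ, e 0 = a ∧
      (∀ i ≤ t, e i ∈ stepsTo H h (t - i) ∧ ∀ s < t - i, e i ∉ stepsTo H h s) ∧
      ∀ i < t, e i < e (i + 1) ∧ H (e i) (e (i + 1)) := by
  induction t generalizing a with
  | zero => exact ⟨fun _ => a, rfl, fun i hi => ⟨by simpa using ha, by omega⟩, by omega⟩
  | succ t ih =>
    rcases ha with ha' | ⟨c, hc, hac, hH⟩
    · exact absurd ha' (hmin t (by omega))
    obtain ⟨e, he0, he, hstep⟩ := ih hc fun s hs hcs =>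
      hmin (s + 1) (by omega) (Or.inr ⟨c, hcs, hac, hH⟩)
    refine ⟨fun i => Nat.casesOn i a e, rfl, ?_, ?_⟩
    · rintro (_ | i) hi
      · exact ⟨Or.inr ⟨c, hc, hac, hH⟩, hmin⟩
      · simpa using he i (by omega)
    · rintro (_ | i) hi
      · simpa [he0] using ⟨hac, hH⟩
      · exact hstep i (by omega)

/-- If `i` is joined to `i + 1` for all `i < h`, and the number of backward neighbours is
bounded, then for large `h` there is a long increasing induced path. -/
theorem exists_increasing_inducedPath (m n : ℕ) :
    ∃ h : ℕ, ∀ H : ℕ → ℕ → Prop, (∀ i < h, H i (i + 1)) →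
      (∀ j ≤ h, {i | i < j ∧ H i j}.encard ≤ m) →
      ∃ e : ℕ → ℕ, (∀ i < n, e i < e (i + 1)) ∧ (∀ i ≤ n, e i ≤ h) ∧
        ∀ i j, i < j → j ≤ n → (H (e i) (e j) ↔ j = i + 1) := by
  refine ⟨(m + 1) ^ n, fun H hpath hback => ?_⟩
  set h := (m + 1) ^ n
  -- Otherwise `stepsTo H h n` is closed under backward steps and contains all `h + 1` numbers up to
  -- `h`, but it has at most `(m + 1) ^ n = h` elements.
  obtain ⟨a, ha, hmin⟩ : ∃ a ∈ stepsTo H h (n + 1), a ∉ stepsTo H h n := by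
    by_contra! hcon
    have hall : ∀ k ≤ h, h - k ∈ stepsTo H h n := by
      intro k
      induction k with
      | zero => exact fun _ => stepsTo_mono H h (Nat.zero_le n) rfl
      | succ k ih =>
        intro hk
        have hp := hpath (h - (k + 1)) (by omega)
        rw [show h - (k + 1) + 1 = h - k by omega] at hp
        exact hcon _ (Or.inr ⟨h - k, ih (by omega), by omega, hp⟩)
    have hsub : Set.Iic h ⊆ stepsTo H h n := fun a ha => by
      have := hall (h - a) (by omega)
      rwa [show h - (h - a) = a from Nat.sub_sub_self ha] at this
    have h1 := Set.ncard_le_ncard hsub ((Set.finite_Iic h).subset fun _ => stepsTo_le)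
    have h2 := stepsTo_ncard_le hback n
    have h3 : (Set.Iic h).ncard = h + 1 := by
      rw [← Finset.coe_Iic, Set.ncard_coe_finset, Nat.card_Iic]
    omega
  obtain ⟨e, -, he, hstep⟩ := exists_geodesic ha fun s hs hsa =>
    hmin (stepsTo_mono H h (Nat.lt_succ_iff.1 hs) hsa)
  have hlt : ∀ i j, i < j → j ≤ n + 1 → e i < e j := by
    intro i j hij
    induction j, hij using Nat.le_induction with
    | base => exact fun hj => (hstep i (by omega)).1
    | succ j hij ih => exact fun hj => (ih (by omega)).trans (hstep j (by omega)).1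
  refine ⟨e, fun i hi => (hstep i (by omega)).1, fun i hi => stepsTo_le (he i (by omega)).1,
    fun i j hij hj => ⟨fun hH => ?_, ?_⟩⟩
  -- A chord would put `e i` within `n + 1 - j + 1` steps of `h`, fewer than its distance `n + 1 -
  -- i`.
  · by_contra hne
    exact (he i (by omega)).2 (n + 1 - j + 1) (by omega)
      (Or.inr ⟨e j, (he j (by omega)).1, hlt i j hij (by omega), hH⟩)
  · rintro rfl
    exact (hstep i (by omega)).2

/-! ### Trees of words -/

/-- Words of length at most `h` over the alphabet `{0, …, b - 1}`, read from the root of the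
`b`-ary tree of height `h` on. -/
def Words (b h : ℕ) : Set (List ℕ) := {w | w.length ≤ h ∧ ∀ a ∈ w, a < b}

theorem nil_mem_words (b h : ℕ) : [] ∈ Words b h := by simp [Words]

theorem cons_mem_words {b h c : ℕ} {w : List ℕ} :
    c :: w ∈ Words b (h + 1) ↔ c < b ∧ w ∈ Words b h := by
  simp only [Words, Set.mem_ofPred_eq, List.length_cons, Nat.add_le_add_iff_right, List.mem_cons,
    forall_eq_or_imp]
  tauto

theorem Words.mono {b b' h h' : ℕ} (hb : b ≤ b') (hh : h ≤ h') : Words b h ⊆ Words b' h' :=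
  fun _ hw => ⟨hw.1.trans hh, fun a ha => (hw.2 a ha).trans_le hb⟩

theorem Words.of_prefix {b h : ℕ} {u v : List ℕ} (hv : v ∈ Words b h) (huv : u <+: v) :
    u ∈ Words b h :=
  ⟨huv.length_le.trans hv.1, fun a ha => hv.2 a (huv.subset ha)⟩

theorem finite_words (b h : ℕ) : (Words b h).Finite := by
  induction h with
  | zero => exact (Set.finite_singleton []).subset fun _ hw =>
      List.length_eq_zero_iff.1 (Nat.le_zero.1 hw.1)
  | succ h ih =>
    refine ((Set.finite_singleton []).union
      (((Set.finite_Iio b).prod ih).image fun x => x.1 :: x.2)).subset ?_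
    rintro (_ | ⟨c, w⟩) hw
    · simp
    · exact Or.inr ⟨(c, w), cons_mem_words.1 hw, rfl⟩

/-- `σ` embeds the `b`-ary tree of height `h` into the `B`-ary one, preserving levels. -/
structure IsSubtreeMap (b B h : ℕ) (σ : List ℕ → List ℕ) : Prop where
  length_eq : ∀ w ∈ Words b h, (σ w).length = w.length
  lt : ∀ w ∈ Words b h, ∀ a ∈ σ w, a < B
  mono : ∀ u ∈ Words b h, ∀ v ∈ Words b h, u <+: v → σ u <+: σ v
  injOn : Set.InjOn σ (Words b h)

theorem IsSubtreeMap.mapsTo {b B h : ℕ} {σ : List ℕ → List ℕ} (hσ : IsSubtreeMap b B h σ) :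
    Set.MapsTo σ (Words b h) (Words B h) :=
  fun w hw => ⟨(hσ.length_eq w hw).le.trans hw.1, hσ.lt w hw⟩

theorem IsSubtreeMap.prefix_iff {b B h : ℕ} {σ : List ℕ → List ℕ} (hσ : IsSubtreeMap b B h σ)
    {u v : List ℕ} (hu : u ∈ Words b h) (hv : v ∈ Words b h) : σ u <+: σ v ↔ u <+: v := by
  refine ⟨fun huv => ?_, hσ.mono u hu v hv⟩
  have hlen := huv.length_le
  rw [hσ.length_eq u hu, hσ.length_eq v hv] at hlen
  have hpre := List.take_prefix u.length v
  have hw := Words.of_prefix hv hpre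
  have : σ (v.take u.length) = σ u :=
    (List.prefix_of_prefix_length_le (hσ.mono _ hw _ hv hpre) huv
      (by simp [hσ.length_eq _ hw, hσ.length_eq _ hu])).eq_of_length
      (by simp [hσ.length_eq _ hw, hσ.length_eq _ hu, hlen])
  rw [← hσ.injOn hw hu this]
  exact hpre

theorem IsSubtreeMap.id {b B h : ℕ} (hb : b ≤ B) : IsSubtreeMap b B h id :=
  ⟨fun _ _ => rfl, fun _ hw a ha => (hw.2 a ha).trans_le hb, fun _ _ _ _ h => h,
    Set.injOn_id _⟩

/-- The map of trees acting by `π` on the children of the root and by `σ c` on the subtree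
at the child `c`. -/
def graft (π : ℕ → ℕ) (σ : ℕ → List ℕ → List ℕ) : List ℕ → List ℕ
  | [] => []
  | c :: w => π c :: σ c w

theorem IsSubtreeMap.graft {b B' B h : ℕ} {π : ℕ → ℕ} {σ : ℕ → List ℕ → List ℕ}
    (hσ : ∀ c < b, IsSubtreeMap b B' h (σ c)) (hB : B' ≤ B) (hπ : ∀ c < b, π c < B)
    (hinj : ∀ c d, c < d → d < b → π c < π d) :
    IsSubtreeMap b B (h + 1) (graft π σ) where
  length_eq := by
    rintro (_ | ⟨c, w⟩) hw
    · rfl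
    · obtain ⟨hc, hw⟩ := cons_mem_words.1 hw
      simp [_root_.graft, (hσ c hc).length_eq w hw]
  lt := by
    rintro (_ | ⟨c, w⟩) hw a ha
    · simp [_root_.graft] at ha
    · obtain ⟨hc, hw⟩ := cons_mem_words.1 hw
      rcases List.mem_cons.1 ha with rfl | ha
      · exact hπ c hc
      · exact ((hσ c hc).lt w hw a ha).trans_le hB
  mono := by
    rintro (_ | ⟨c, u⟩) hu (_ | ⟨d, v⟩) hv huv
    · simp
    · simp [_root_.graft]
    · simp at huv
    · obtain ⟨rfl, huv'⟩ := List.cons_prefix_cons.1 huv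
      obtain ⟨hc, hu'⟩ := cons_mem_words.1 hu
      exact List.cons_prefix_cons.2 ⟨rfl, (hσ c hc).mono u hu' v (cons_mem_words.1 hv).2 huv'⟩
  injOn := by
    rintro (_ | ⟨c, u⟩) hu (_ | ⟨d, v⟩) hv huv
    · rfl
    · simp [_root_.graft] at huv
    · simp [_root_.graft] at huv
    · obtain ⟨h1, h2⟩ := List.cons.inj huv
      obtain ⟨hc, hu'⟩ := cons_mem_words.1 hu
      obtain ⟨hd, hv'⟩ := cons_mem_words.1 hv
      have : c = d := by
        rcases lt_trichotomy c d with h | h | h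
        · exact absurd h1 (hinj c d h hd).ne
        · exact h
        · exact absurd h1 (hinj d c h hc).ne'
      subst this
      rw [(hσ c hc).injOn hu' hv' h2]

/-- If the leaves of a tree of large branching are coloured, then some subtree of branching `b`
has leaves of one colour only. -/
theorem exists_monochromatic_leaves (C : Type) [Finite C] (b h : ℕ) :
    ∃ B : ℕ, ∀ χ : List ℕ → C, ∃ σ, IsSubtreeMap b B h σ ∧
      ∃ κ, ∀ w ∈ Words b h, w.length = h → χ (σ w) = κ := by
  induction h with
  | zero =>
    refine ⟨b, fun χ => ⟨id, IsSubtreeMap.id le_rfl, χ [], fun w _ hw => ?_⟩⟩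
    rw [List.length_eq_zero_iff.1 hw]; rfl
  | succ h ih =>
    obtain ⟨B', hB'⟩ := ih
    -- The pair colouring used below looks only at the smaller child, so the last of the `b + 1`
    -- children is sacrificed.
    obtain ⟨R, hR⟩ := exists_ramsey C (b + 1)
    refine ⟨max B' R, fun χ => ?_⟩
    choose σ hσ κ hκ using fun c => hB' fun w => χ (c :: w)
    obtain ⟨g, k, hgR, hg⟩ := hR fun i _ => κ i
    refine ⟨graft g (fun c => σ (g c)), IsSubtreeMap.graft (fun c _ => hσ (g c))
      (le_max_left _ _) (fun c hc => (hgR c (by omega)).trans_le (le_max_right _ _))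
      (fun c d hcd hd => (hg c d hcd (by omega)).1), k, ?_⟩
    rintro (_ | ⟨c, w⟩) hw hlen
    · simp at hlen
    · obtain ⟨hc, hw⟩ := cons_mem_words.1 hw
      exact (hκ (g c) w hw (by simpa using hlen)).trans (hg c b hc (by omega)).2

/-- In a graph without large bicliques, a tree of large branching has a subtree of branching `b`
whose only edges join comparable vertices. -/
theorem exists_subtree_without_cross_edges (b h m : ℕ) :
    ∃ B : ℕ, ∀ {V : Type*} (G : SimpleGraph V), ¬ HasBiclique G m →
      ∀ f : List ℕ → V, Set.InjOn f (Words B h) → ∃ σ, IsSubtreeMap b B h σ ∧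
        ∀ u ∈ Words b h, ∀ v ∈ Words b h, ¬ u <+: v → ¬ v <+: u →
          ¬ G.Adj (f (σ u)) (f (σ v)) := by
  induction h with
  | zero =>
    refine ⟨b, fun G _ f _ => ⟨id, IsSubtreeMap.id le_rfl, fun u hu v _ huv => ?_⟩⟩
    rw [List.length_eq_zero_iff.1 (Nat.le_zero.1 hu.1)] at huv
    simp at huv
  | succ h ih =>
    classical
    obtain ⟨B', hB'⟩ := ih
    have := (finite_words b h).to_subtype
    -- Enough children both for the `b` branches wanted and for the two sides of a `K_{m,m}`.
    obtain ⟨R, hR⟩ := exists_ramsey (Option (Words b h × Words b h)) (b + 2 * m)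
    refine ⟨max B' R, fun G hG f hf => ?_⟩
    have hsub : ∀ c < R, ∀ w ∈ Words B' h, c :: w ∈ Words (max B' R) (h + 1) := fun c hc w hw =>
      cons_mem_words.2 ⟨hc.trans_le (le_max_right _ _), Words.mono (le_max_left _ _) le_rfl hw⟩
    have hex : ∀ c, ∃ σ, c < R → IsSubtreeMap b B' h σ ∧
        ∀ u ∈ Words b h, ∀ v ∈ Words b h, ¬ u <+: v → ¬ v <+: u →
          ¬ G.Adj (f (c :: σ u)) (f (c :: σ v)) := by
      intro c
      by_cases hc : c < R
      · obtain ⟨σ, hσ⟩ := hB' G hG (fun w => f (c :: w)) fun u hu v hv huv =>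
          (List.cons.inj (hf (hsub c hc u hu) (hsub c hc v hv) huv)).2
        exact ⟨σ, fun _ => hσ⟩
      · exact ⟨id, fun h => absurd h hc⟩
    choose σ hσ using hex
    obtain ⟨g, k, hgR, hg⟩ := hR fun i j =>
      if h : ∃ x : Words b h × Words b h, G.Adj (f (i :: σ i x.1)) (f (j :: σ j x.2))
      then some h.choose else none
    have hinj : ∀ (o : ℕ), o + m ≤ b + 2 * m → ∀ x ∈ Words b h,
        Function.Injective fun i : Fin m => f (g (o + i) :: σ (g (o + i)) x) := by
      intro o ho x hx i j hij
      have hi := hgR (o + i) (by omega)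
      have hj := hgR (o + j) (by omega)
      have := (List.cons.inj (hf (hsub _ hi _ ((hσ _ hi).1.mapsTo hx))
        (hsub _ hj _ ((hσ _ hj).1.mapsTo hx)) hij)).1
      rcases lt_trichotomy i j with h | h | h
      · have := (hg (o + i) (o + j) (by omega) (by omega)).1; omega
      · exact h
      · have := (hg (o + j) (o + i) (by omega) (by omega)).1; omega
    -- If the colour were `some x`, the copies of `x.1` below the first `m` children and of `x.2`
    -- below the next `m` would form a `K_{m,m}`.
    have hk : k = none := by
      cases k with
      | none => rfl
      | some x =>
        refine absurd ⟨_, _, hinj 0 (by omega) x.1 x.1.2, hinj m (by omega) x.2 x.2.2, ?_⟩ hG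
        intro i j
        have h1 := (hg (0 + i) (m + j) (by omega) (by omega)).2
        split_ifs at h1 with h2
        have h3 := h2.choose_spec
        rwa [Option.some.inj h1] at h3
    subst hk
    have hcross : ∀ c d, c < d → d < b → ∀ u ∈ Words b h, ∀ v ∈ Words b h,
        ¬ G.Adj (f (g c :: σ (g c) u)) (f (g d :: σ (g d) v)) := by
      intro c d hcd hd u hu v hv hadj
      have h1 := (hg c d hcd (by omega)).2
      rw [dif_pos ⟨(⟨u, hu⟩, ⟨v, hv⟩), hadj⟩] at h1
      simp at h1
    refine ⟨graft g (fun c => σ (g c)), IsSubtreeMap.graft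
      (fun c hc => (hσ (g c) (hgR c (by omega))).1)
      (le_max_left _ _) (fun c hc => (hgR c (by omega)).trans_le (le_max_right _ _))
      (fun c d hcd hd => (hg c d hcd (by omega)).1), ?_⟩
    rintro (_ | ⟨c, u⟩) hu (_ | ⟨d, v⟩) hv huv hvu
    · simp at huv
    · simp at huv
    · simp at hvu
    · obtain ⟨hc, hu'⟩ := cons_mem_words.1 hu
      obtain ⟨hd, hv'⟩ := cons_mem_words.1 hv
      rcases lt_trichotomy c d with h | h | h
      · exact hcross c d h hd u hu' v hv'
      · subst h
        rw [List.cons_prefix_cons] at huv hvu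
        exact (hσ (g c) (hgR c (by omega))).2 u hu' v hv' (by simpa using huv) (by simpa using hvu)
      · exact fun hadj => hcross d c h hc v hv' u hu' hadj.symm

theorem IsSubtreeMap.take {b B h : ℕ} {σ : List ℕ → List ℕ} (hσ : IsSubtreeMap b B h σ)
    {w : List ℕ} (hw : w ∈ Words b h) (i : ℕ) : (σ w).take i = σ (w.take i) := by
  have hpre := List.take_prefix i w
  have hlen := hσ.length_eq _ (Words.of_prefix hw hpre)
  have h1 := List.prefix_iff_eq_take.1 (hσ.mono _ (Words.of_prefix hw hpre) _ hw hpre)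
  rw [h1, hlen, List.length_take, ← hσ.length_eq w hw, ← List.take_eq_take_min]

/-- Insert `gap j` zeros after the `j`-th letter, counting from the given start. -/
def stretch (gap : ℕ → ℕ) : ℕ → List ℕ → List ℕ
  | _, [] => []
  | j, a :: w => a :: (List.replicate (gap j) 0 ++ stretch gap (j + 1) w)

theorem stretch_injective (gap : ℕ → ℕ) (j : ℕ) : Function.Injective (stretch gap j) := by
  intro u
  induction u generalizing j with
  | nil => rintro (_ | ⟨d, v⟩) huv <;> simp_all [stretch]
  | cons c u ih =>
    rintro (_ | ⟨d, v⟩) huv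
    · simp [stretch] at huv
    · obtain ⟨h1, h2⟩ := List.cons.inj huv
      rw [h1, ih (j + 1) (List.append_cancel_left h2)]

theorem stretch_prefix (gap : ℕ → ℕ) (j : ℕ) {u v : List ℕ} (huv : u <+: v) :
    stretch gap j u <+: stretch gap j v := by
  induction u generalizing j v with
  | nil => simp [stretch]
  | cons c u ih =>
    obtain ⟨t, rfl⟩ := huv
    exact List.cons_prefix_cons.2
      ⟨rfl, (List.prefix_append_right_inj _).2 (ih (j + 1) (List.prefix_append u t))⟩

theorem lt_of_mem_stretch {gap : ℕ → ℕ} {j b : ℕ} (hb : 0 < b) {w : List ℕ}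
    (hw : ∀ a ∈ w, a < b) : ∀ a ∈ stretch gap j w, a < b := by
  induction w generalizing j with
  | nil => simp [stretch]
  | cons c w ih =>
    intro a ha
    rw [stretch, List.mem_cons, List.mem_append, List.mem_replicate] at ha
    rcases ha with rfl | ⟨-, rfl⟩ | ha
    · exact hw _ List.mem_cons_self
    · exact hb
    · exact ih (fun a ha => hw a (List.mem_cons_of_mem _ ha)) a ha

/-- One letter and its `e (j + 1) - e j - 1` zeros lead from level `e j` to level `e (j + 1)`. -/
theorem length_stretch {e : ℕ → ℕ} {n : ℕ} (he : ∀ i < n, e i < e (i + 1)) {j : ℕ}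
    {w : List ℕ} (hw : j + w.length ≤ n) :
    e j + (stretch (fun i => e (i + 1) - e i - 1) j w).length = e (j + w.length) := by
  induction w generalizing j with
  | nil => simp [stretch]
  | cons c w ih =>
    rw [List.length_cons] at hw
    have h1 := ih (j := j + 1) (by omega)
    have h2 := he j (by omega)
    simp only [stretch, List.length_cons, List.length_append, List.length_replicate]
    rw [show j + (w.length + 1) = j + 1 + w.length by omega]
    omega

/-- In a graph without large bicliques, a tree of large height and branching contains, up to
contracting levels, a tree of branching `b` and height `n` in which a vertex is adjacent to a
descendant only if the latter is a child. -/
theorem exists_subtree_without_back_edges (b n m : ℕ) :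
    ∃ B h : ℕ, ∀ {V : Type*} (G : SimpleGraph V), ¬ HasBiclique G m →
      ∀ f : List ℕ → V, Set.InjOn f (Words B h) →
        (∀ u a, u ++ [a] ∈ Words B h → G.Adj (f u) (f (u ++ [a]))) →
        ∃ τ : List ℕ → List ℕ, Set.MapsTo τ (Words b n) (Words B h) ∧
          Set.InjOn τ (Words b n) ∧ ∀ u ∈ Words b n, ∀ v ∈ Words b n, u <+: v → u ≠ v →
            (G.Adj (f (τ u)) (f (τ v)) ↔ v.length = u.length + 1) := by
  obtain ⟨h, hh⟩ := exists_increasing_inducedPath m n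
  -- This branching leaves room for the `b` letters of the final tree and for `m` siblings in a
  -- biclique; the extra one makes the letter `0` available in every case.
  obtain ⟨B, hB⟩ := exists_monochromatic_leaves (Fin (h + 1) × Fin (h + 1) → Prop) (b + m + 1) h
  refine ⟨B, h, fun G hG f hf hadj => ?_⟩
  obtain ⟨σ, hσ, κ, hκ⟩ := hB fun w p => G.Adj (f (w.take p.1)) (f (w.take p.2))
  set W := Words (b + m + 1) h
  -- `Fin.ofNat` reduces modulo `h + 1`, which is harmless since only levels up to `h` matter.
  set H : ℕ → ℕ → Prop := fun i j => κ (Fin.ofNat _ i, Fin.ofNat _ j)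
  have hH : ∀ u ∈ W, ∀ v ∈ W, u <+: v →
      (G.Adj (f (σ u)) (f (σ v)) ↔ H u.length v.length) := by
    intro u hu v hv huv
    -- Both vertices lie on the root path of the leaf obtained by padding `v` with zeros.
    have hvw : v <+: v ++ List.replicate (h - v.length) 0 := List.prefix_append _ _
    have hlen : (v ++ List.replicate (h - v.length) 0).length = h := by
      have := hv.1
      simp; omega
    have hw : v ++ List.replicate (h - v.length) 0 ∈ W := by
      refine ⟨hlen.le, fun a ha => ?_⟩
      rcases List.mem_append.1 ha with ha | ha
      · exact hv.2 a ha
      · rw [(List.mem_replicate.1 ha).2]; omega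
    have h1 := congrFun (hκ _ hw hlen) (Fin.ofNat _ u.length, Fin.ofNat _ v.length)
    simp only [Fin.val_ofNat, Nat.mod_eq_of_lt (Nat.lt_succ_of_le hu.1),
      Nat.mod_eq_of_lt (Nat.lt_succ_of_le hv.1), hσ.take hw,
      ← List.prefix_iff_eq_take.1 hvw, ← List.prefix_iff_eq_take.1 (huv.trans hvw)] at h1
    exact iff_of_eq h1
  have hzero : ∀ i ≤ h, List.replicate i 0 ∈ W := fun i hi =>
    ⟨by simpa using hi, fun a ha => by rw [(List.mem_replicate.1 ha).2]; omega⟩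
  have hfσ : Set.InjOn (f ∘ σ) W := hf.comp hσ.injOn hσ.mapsTo
  have hsnoc : ∀ j < h, ∀ a < m + 1, List.replicate j 0 ++ [a] ∈ W := by
    intro j hj a ha
    refine ⟨by simp; omega, fun c hc => ?_⟩
    rcases List.mem_append.1 hc with hc | hc
    · rw [(List.mem_replicate.1 hc).2]; omega
    · rw [List.mem_singleton.1 hc]; omega
  have hpath : ∀ i < h, H i (i + 1) := by
    intro i hi
    have h1 := hH _ (hzero i hi.le) _ (hsnoc i hi 0 (by omega)) (List.prefix_append _ _)
    simp only [List.length_replicate, List.length_append, List.length_singleton] at h1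
    rw [← h1]
    have hmem := hsnoc i hi 0 (by omega)
    have h2 : σ (List.replicate i 0 ++ [0]) ≠ [] := by
      rw [← List.length_pos_iff, hσ.length_eq _ hmem]; simp
    have h3 : σ (List.replicate i 0) = (σ (List.replicate i 0 ++ [0])).dropLast := by
      rw [List.dropLast_eq_take, hσ.length_eq _ hmem, hσ.take hmem]
      simp
    rw [h3]
    have h4 := List.dropLast_append_getLast h2
    have h5 := hadj (σ (List.replicate i 0 ++ [0])).dropLast
      ((σ (List.replicate i 0 ++ [0])).getLast h2)
    rw [h4] at h5
    exact h5 (hσ.mapsTo hmem)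
  -- Words of zeros at `m` smaller neighbouring levels are common ancestors of the siblings `0 … 0
  -- a` at level `j`, so they and `m` such siblings form a `K_{m,m}`.
  have hback : ∀ j ≤ h, {i | i < j ∧ H i j}.encard ≤ m := by
    intro j hj
    by_contra! hcard
    obtain ⟨S, hS, hScard⟩ := Set.exists_subset_encard_eq hcard.le
    have hSfin : S.Finite := Set.finite_of_encard_eq_coe hScard
    have hcard' : hSfin.toFinset.card = m := by
      rw [← Nat.cast_inj (R := ℕ∞), ← hScard, hSfin.encard_eq_coe_toFinset_card]
    have hs : ∀ s : Fin m, (hSfin.toFinset.orderEmbOfFin hcard' s) ∈ S := fun s =>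
      hSfin.mem_toFinset.1 (Finset.orderEmbOfFin_mem _ _ s)
    refine hG ⟨fun s => f (σ (List.replicate (hSfin.toFinset.orderEmbOfFin hcard' s) 0)),
      fun s => f (σ (List.replicate (j - 1) 0 ++ [s.1])), ?_, ?_, ?_⟩
    · intro s t hst
      have h1 := hS (hs s)
      have h2 := hS (hs t)
      have h3 := congrArg List.length
        (hfσ (hzero _ (h1.1.le.trans hj)) (hzero _ (h2.1.le.trans hj)) hst)
      exact (hSfin.toFinset.orderEmbOfFin hcard').injective (by simpa using h3)
    · intro s t hst
      have hpos := (hS (hs s)).1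
      have h3 := hfσ (hsnoc (j - 1) (by omega) _ (by omega))
        (hsnoc (j - 1) (by omega) _ (by omega)) hst
      exact Fin.ext (by simpa using h3)
    · intro s t
      have h1 := hS (hs s)
      have hpos := h1.1
      rw [hH _ (hzero _ (h1.1.le.trans hj)) _ (hsnoc (j - 1) (by omega) _ (by omega))]
      · simpa [show j - 1 + 1 = j by omega] using h1.2
      · refine List.IsPrefix.trans ?_ (List.prefix_append _ _)
        exact ⟨List.replicate (j - 1 - hSfin.toFinset.orderEmbOfFin hcard' s) 0, by
          rw [List.replicate_append_replicate]; congr 1; omega⟩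
  obtain ⟨e, he, heh, hind⟩ := hh H hpath hback
  have hlen : ∀ w ∈ Words b n, (List.replicate (e 0) 0 ++
      stretch (fun i => e (i + 1) - e i - 1) 0 w).length = e w.length := by
    intro w hw
    rw [List.length_append, List.length_replicate, length_stretch he (by simpa using hw.1),
      Nat.zero_add]
  have hmem : ∀ w ∈ Words b n, (List.replicate (e 0) 0 ++
      stretch (fun i => e (i + 1) - e i - 1) 0 w) ∈ W := by
    intro w hw
    refine ⟨(hlen w hw).le.trans (heh _ hw.1), fun a ha => ?_⟩
    rcases List.mem_append.1 ha with ha | ha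
    · rw [(List.mem_replicate.1 ha).2]; omega
    · exact lt_of_mem_stretch (by omega) (fun a ha => (hw.2 a ha).trans_le (by omega)) a ha
  refine ⟨fun w => σ (List.replicate (e 0) 0 ++ stretch (fun i => e (i + 1) - e i - 1) 0 w),
    fun w hw => hσ.mapsTo (hmem w hw), fun u hu v hv huv => ?_, fun u hu v hv huv hne => ?_⟩
  · exact stretch_injective _ _ (List.append_cancel_left (hσ.injOn (hmem u hu) (hmem v hv) huv))
  · rw [hH _ (hmem u hu) _ (hmem v hv)
      ((List.prefix_append_right_inj _).2 (stretch_prefix _ _ huv)), hlen u hu, hlen v hv]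
    exact hind _ _ (lt_of_le_of_ne huv.length_le fun h => hne (huv.eq_of_length h)) hv.1

/-! ### The `n`-tree in terms of words -/

/-- A word read from the root on, as a vertex of the `N`-tree. -/
def toKaryWord {N : ℕ} (w : List ℕ) (hw : w ∈ Words N N) : KaryWord N N :=
  ⟨(w.pmap Fin.mk hw.2).reverse, by simpa using hw.1⟩

/-- The vertex of the `n`-tree as a word read from the root on. -/
def ofKaryWord {n : ℕ} (w : KaryWord n n) : List ℕ := (w.1.map Fin.val).reverse

theorem ofKaryWord_mem {n : ℕ} (w : KaryWord n n) : ofKaryWord w ∈ Words n n := by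
  refine ⟨by simpa [ofKaryWord] using w.2, fun a ha => ?_⟩
  simp only [ofKaryWord, List.mem_reverse, List.mem_map] at ha
  obtain ⟨c, -, rfl⟩ := ha
  exact c.2

theorem ofKaryWord_injective {n : ℕ} : Function.Injective (ofKaryWord (n := n)) := fun _ _ h =>
  Subtype.ext (List.map_injective_iff.2 Fin.val_injective (List.reverse_injective h))

theorem ofKaryWord_toKaryWord {N : ℕ} (w : List ℕ) (hw : w ∈ Words N N) :
    ofKaryWord (toKaryWord w hw) = w := by
  simp [ofKaryWord, toKaryWord, List.map_pmap]

/-- Children are formed by prepending a letter, so ancestors are suffixes; reversal turns them into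
prefixes. -/
theorem exists_eq_cons_iff {n : ℕ} (u v : KaryWord n n) :
    (∃ a, v.1 = a :: u.1) ↔ ofKaryWord u <+: ofKaryWord v ∧
      (ofKaryWord v).length = (ofKaryWord u).length + 1 := by
  simp only [ofKaryWord, List.reverse_prefix, List.length_reverse, List.length_map]
  constructor
  · rintro ⟨a, ha⟩
    simp [ha]
  · rintro ⟨hsuf, hlen⟩
    obtain ⟨v, hv⟩ := v
    cases v with
    | nil => simp at hlen
    | cons a w =>
      refine ⟨a, ?_⟩
      rw [List.map_cons, List.suffix_cons_iff] at hsuf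
      rcases hsuf with hsuf | hsuf
      · have := congrArg List.length hsuf
        simp only [List.length_map, List.length_cons] at this hlen
        omega
      · have := hsuf.eq_of_length (by simpa using hlen.symm)
        rw [List.map_injective_iff.2 Fin.val_injective this]

theorem nTree_adj_iff {n : ℕ} (u v : KaryWord n n) :
    (nTree n).Adj u v ↔
      (ofKaryWord u <+: ofKaryWord v ∧ (ofKaryWord v).length = (ofKaryWord u).length + 1) ∨
      (ofKaryWord v <+: ofKaryWord u ∧ (ofKaryWord u).length = (ofKaryWord v).length + 1) :=
  or_congr (exists_eq_cons_iff u v) (exists_eq_cons_iff v u)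

theorem theorem2 (n : ℕ) :
    ∃ N : ℕ, ∀ (V : Type*) [Finite V] (G : SimpleGraph V),
      (nTree N).IsContained G →
        (SimpleGraph.completeGraph (Fin n)).IsIndContained G ∨
        (completeBipartiteGraph (Fin n) (Fin n)).IsIndContained G ∨
        (nTree n).IsIndContained G := by
  classical
  obtain ⟨m, hm⟩ := exists_forall_hasBiclique_imp n
  -- Cross edges are removed last, so the branching `b` needed for this is demanded of the back-edge
  -- step.
  obtain ⟨b, hb⟩ := exists_subtree_without_cross_edges n n m
  obtain ⟨B, h, hBh⟩ := exists_subtree_without_back_edges b n m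
  refine ⟨max B h, fun V _ G => ?_⟩
  rintro ⟨φ⟩
  by_cases hG : HasBiclique G m
  · exact (hm G hG).imp_right Or.inl
  refine Or.inr (Or.inr ?_)
  set N := max B h
  have hsub : Words B h ⊆ Words N N := Words.mono (le_max_left _ _) (le_max_right _ _)
  -- Outside `Words N N` the value is a dummy, the image of the root.
  set f : List ℕ → V := fun w =>
    if hw : w ∈ Words N N then φ (toKaryWord w hw) else φ (toKaryWord [] (nil_mem_words N N))

  have hfeq : ∀ w (hw : w ∈ Words N N), f w = φ (toKaryWord w hw) := fun w hw => dif_pos hw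
  obtain ⟨τ, hmaps, hτinj, hτ⟩ := hBh G hG f
    (by
      intro u hu v hv huv
      rw [hfeq u (hsub hu), hfeq v (hsub hv)] at huv
      have := congrArg ofKaryWord (φ.injective huv)
      rwa [ofKaryWord_toKaryWord, ofKaryWord_toKaryWord] at this)
    (by
      intro u a hua
      have hu := Words.of_prefix (hsub hua) (List.prefix_append u [a])
      rw [hfeq _ hu, hfeq _ (hsub hua)]
      refine φ.toHom.map_adj ((nTree_adj_iff _ _).2 (Or.inl ?_))
      simp [ofKaryWord_toKaryWord])
  have hfinj : Set.InjOn (f ∘ τ) (Words b n) := by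
    refine Set.InjOn.comp (fun u hu v hv huv => ?_) hτinj hmaps
    rw [hfeq u (hsub hu), hfeq v (hsub hv)] at huv
    have := congrArg ofKaryWord (φ.injective huv)
    rwa [ofKaryWord_toKaryWord, ofKaryWord_toKaryWord] at this
  obtain ⟨σ, hσ, hcross⟩ := hb G hG (f ∘ τ) hfinj
  -- Since `σ` preserves levels and prefixes, the adjacency rule for comparable vertices survives
  -- the second thinning.
  have hcomp : ∀ u v : KaryWord n n, u ≠ v → ofKaryWord u <+: ofKaryWord v →
      (G.Adj (f (τ (σ (ofKaryWord u)))) (f (τ (σ (ofKaryWord v)))) ↔ (nTree n).Adj u v) := by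
    intro u v hne huv
    have hu := ofKaryWord_mem u
    have hv := ofKaryWord_mem v
    rw [hτ _ (hσ.mapsTo hu) _ (hσ.mapsTo hv) (hσ.mono _ hu _ hv huv)
      (fun h => hne (ofKaryWord_injective (hσ.injOn hu hv h))), hσ.length_eq _ hu,
      hσ.length_eq _ hv, nTree_adj_iff]
    have := huv.length_le
    constructor
    · exact fun h => Or.inl ⟨huv, h⟩
    · rintro (⟨-, h⟩ | ⟨-, h⟩) <;> omega
  refine ⟨⟨⟨fun w => f (τ (σ (ofKaryWord w))), fun u v huv => ?_⟩, fun {u v} => ?_⟩⟩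
  · exact ofKaryWord_injective (hσ.injOn (ofKaryWord_mem u) (ofKaryWord_mem v)
      (hfinj (hσ.mapsTo (ofKaryWord_mem u)) (hσ.mapsTo (ofKaryWord_mem v)) huv))
  · change G.Adj (f (τ (σ (ofKaryWord u)))) (f (τ (σ (ofKaryWord v)))) ↔ (nTree n).Adj u v
    by_cases hne : u = v
    · subst hne
      exact iff_of_false (G.loopless.irrefl _) ((nTree n).loopless.irrefl _)
    by_cases huv : ofKaryWord u <+: ofKaryWord v
    · exact hcomp u v hne huv
    by_cases hvu : ofKaryWord v <+: ofKaryWord u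
    · rw [G.adj_comm, (nTree n).adj_comm]
      exact hcomp v u (Ne.symm hne) hvu
    · refine iff_of_false (hcross _ (ofKaryWord_mem u) _ (ofKaryWord_mem v) huv hvu) ?_
      rw [nTree_adj_iff]
      tauto
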